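/- Let $N, m \ge 1$ be integers. An assignment is a vector $z \in \{1,-1\}^N$ ($z_i = 1$: unit $i$ is treated, $z_i = -1$: control). Let $\mathbb{Z} = \{z^{(1)}, \dots, z^{(m)}\}$ be a set of $m$ assignments, let the realized assignment be uniformly distributed on $\mathbb{Z}$, and let the potential outcomes be $Y(z) = \frac{\tau}{2} z + Y_0$ with $\tau \in \mathbb{R}$ and $Y_0 \in \mathbb{R}^N$. Let $$T(z, Y) = \mathrm{ave}\{Y_i : z_i = 1\} - \mathrm{ave}\{Y_i : z_i = -1\}$$ be the difference in means. For $\alpha \in (0,1)$ the power of the randomization test at level $\alpha$ is $$\beta(\tau; \mathbb{Z}, Y_0) = \frac1m \sum_{k=1}^m \mathbf{1}\left\{ T(z^{(k)}, Y(z^{(k)})) > Q_{1-\alpha}\left(\{T(z^{(l)}, Y(z^{(k)}))\}_{l=1,\dots,m}\right) \right\},$$ where $Q_{1-\alpha}$ of $m$ numbers (counted with multiplicity) is their lower $(1-\alpha)$-quantile, i.e. the $\lceil m(1-\alpha) \rceil$-th of them in ascending order. The average power is $\bar\beta(\tau; \mathbb{Z}) = \mathrm{E}_{Y_0}[\beta(\tau;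 \mathbb{Z}, Y_0)]$. For an assignment $z$ let $\tilde z_i = 1/|\{j : z_j = 1\}|$ if $z_i = 1$ and $\tilde z_i = -1/|\{j : z_j = -1\}|$ if $z_i = -1$. Assume: 1. the components $Y_{0,1}, \dots, Y_{0,N}$ are i.i.d. $N(\mu, \sigma^2)$ with $\mu \in \mathbb{R}$, $\sigma > 0$; 2. (a) there is $p \in (0,1)$ such that $|\{i : z^{(k)}_i = 1\}| / N = p$ for all $k$, and (b) there is $\rho \in [0,1)$ such that $\tilde z^{(k)} \cdot z^{(l)} / 2 = \rho$ for all $k \ne l$. Then $$\bar\beta(\tau; \mathbb{Z}) = \int_{-\infty}^{\infty} F_{\mathrm{bin}}\left(\lfloor m\alpha \rfloor - 1;\ m-1,\ \Phi(z - \Theta)\right) \phi(z)\, dz, \qquad \Theta = \frac{\tau}{\sigma} \sqrt{N\, p(1-p)(1-\rho)},$$ where $F_{\mathrm{bin}}(k; n, q)$ is the cumulative distribution function at $k$ of the binomial distribution with $n$ trials and success probability $q$, and $\Phi$ and $\phi$ are the distribution function and the density of the standard normal distribution. -/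

import Mathlib

open MeasureTheory ProbabilityTheory

noncomputable section

namespace RandTest

/-- An assignment of `N` units: `1` is treatment and `-1` is control
(`ℤˣ` has exactly these two elements). -/
abbrev Assignment (N : ℕ) : Type := Fin N → ℤˣ

variable {N m : ℕ}

/-- The number of units that receive the treatment value `a` under `z`. -/
def groupSize (z : Assignment N) (a : ℤˣ) : ℕ :=
  (Finset.univ.filter fun i => z i = a).card

/-- The average of `y` over the units with treatment value `a` under `z`. -/
def groupMean (z : Assignment N) (a : ℤˣ) (y : Fin N → ℝ) : ℝ :=
  (∑ i ∈ Finset.univ.filter (fun i => z i = a), y i) / (groupSize z a : ℝ)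

/-- The difference-in-means test statistic `T(z, y)`. -/
def diffInMeans (z : Assignment N) (y : Fin N → ℝ) : ℝ :=
  groupMean z 1 y - groupMean z (-1) y

/-- The vector of potential outcomes `Y(z) = (τ / 2) z + Y₀`. -/
def potentialOutcome (τ : ℝ) (y₀ : Fin N → ℝ) (z : Assignment N) : Fin N → ℝ :=
  fun i => τ / 2 * ((z i : ℤ) : ℝ) + y₀ i

/-- The transformed assignment vector: `1 / #treated` on the treated units and
`-1 / #control` on the control units. -/
def transformed (z : Assignment N) : Fin N → ℝ :=
  fun i => if z i = 1 then 1 / (groupSize z 1 : ℝ) else -(1 / (groupSize z (-1) : ℝ))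

/-- The `j`-th number, `1 ≤ j ≤ m`, of the finite family `x` in ascending order
(counted with multiplicity). -/
def orderStat (x : Fin m → ℝ) (j : ℕ) : ℝ :=
  if h : j - 1 < m then x (Tuple.sort x ⟨j - 1, h⟩) else 0

/-- The lower `q`-quantile, `0 < q ≤ 1`, of a nonempty family of `m` numbers:
the `⌈m q⌉`-th number in ascending order. -/
def lowerQuantile (q : ℝ) (x : Fin m → ℝ) : ℝ :=
  orderStat x ⌈(m : ℝ) * q⌉₊

/-- The randomization test over the assignments `z 0, …, z (m - 1)` at level `α` rejects, given the
realized assignment `z k` and the observed outcomes `y`: the observed statistic exceeds the lower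
`(1 - α)`-quantile of its randomization distribution. -/
def Rejects (α : ℝ) (z : Fin m → Assignment N) (k : Fin m) (y : Fin N → ℝ) : Prop :=
  lowerQuantile (1 - α) (fun l => diffInMeans (z l) y) < diffInMeans (z k) y

open scoped Classical in
/-- The power `β(τ; Z, y₀)` of the level-`α` randomization test for base outcomes `y₀`: the
probability of rejection when the realized assignment is uniform on `z 0, …, z (m - 1)`. -/
def power (α τ : ℝ) (z : Fin m → Assignment N) (y₀ : Fin N → ℝ) : ℝ :=
  (1 / (m : ℝ)) * ∑ k, if Rejects α z k (potentialOutcome τ y₀ (z k)) then 1 else 0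

/-- The average power: the expectation of the power over random base outcomes `Y₀`. -/
def averagePower {Ω : Type*} [MeasurableSpace Ω] (P : Measure Ω) (Y₀ : Fin N → Ω → ℝ)
    (α τ : ℝ) (z : Fin m → Assignment N) : ℝ :=
  ∫ ω, power α τ z (fun i => Y₀ i ω) ∂P

/-- The cumulative distribution function of the binomial distribution with `n` trials and success
probability `p`, at an integer `k` (which may be negative). -/
def binomialCDF (k : ℤ) (n : ℕ) (p : unitInterval) : ℝ :=
  (ProbabilityTheory.binomial n p).real {j : ℕ | (j : ℤ) ≤ k}

/-- The standard normal cumulative distribution function `Φ`. -/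
def stdNormalCDF (x : ℝ) : unitInterval :=
  ⟨cdf (gaussianReal 0 1) x, cdf_nonneg _ x, cdf_le_one _ x⟩

/-- The standard normal density `φ`. -/
def stdNormalPDF (x : ℝ) : ℝ := gaussianPDFReal 0 1 x

end RandTest

end

/-! Write `T l` for the statistic of assignment `l` when `k` is realized. It is linear in the
outcomes: treatment contributes `τ` for `l = k` and `τρ` otherwise, and noise contributes
`transformed (z l) · Y₀`. The transformed vectors are equicorrelated contrasts, hence equal to `e -
s a l` with a common shift `e` and orthonormal contrasts `a l`
(`exists_orthonormal_shift_of_equicorrelated`). The shift adds the same amount to every `T l`, so it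
does not affect ranks; what remains is `-sσ V l` with `V` i.i.d. standard normal
(`hasLaw_pi_gaussian_of_orthonormal_contrasts`). Rejection means that at most `⌊mα⌋ - 1` of the
other `T l` reach `T k`, that is, satisfy `V l ≤ V k - Θ`. Given `V k = x`, their number is binomial
with parameters `m - 1` and `Φ(x - Θ)`; integrating over `x` gives the formula. -/

/-! ### Binomial counts in i.i.d. samples -/

theorem measureReal_pi_card_filter_mem_eq {E : Type*} [MeasurableSpace E] (ν : Measure E)
    [IsProbabilityMeasure ν] {A : Set E} [DecidablePred (· ∈ A)] (hA : MeasurableSet A)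
    (n j : ℕ) :
    (Measure.pi fun _ : Fin n => ν).real
        {x | (Finset.univ.filter fun i => x i ∈ A).card = j} =
      n.choose j * ν.real A ^ j * (1 - ν.real A) ^ (n - j) := by
  classical
  -- Splitting by the exact index set that lands in `A` gives disjoint boxes of equal measure.
  have hset : {x : Fin n → E | (Finset.univ.filter fun i => x i ∈ A).card = j} =
      ⋃ s ∈ Finset.powersetCard j (Finset.univ : Finset (Fin n)),
        Set.univ.pi fun i => if i ∈ s then A else Aᶜ := by
    ext x
    simp only [Set.mem_ofPred_eq, Finset.mem_powersetCard, Finset.subset_univ, true_and,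
      Set.mem_iUnion, Set.mem_pi, Set.mem_univ, forall_const, exists_prop]
    constructor
    · intro h
      refine ⟨_, h, fun i => ?_⟩
      by_cases hi : x i ∈ A <;> simp [hi]
    · rintro ⟨s, rfl, h⟩
      congr 1
      ext i
      have := h i
      by_cases hi : i ∈ s <;> simp_all
  rw [hset, measureReal_biUnion_finset]
  · have hs : ∀ s ∈ Finset.powersetCard j (Finset.univ : Finset (Fin n)),
        (Measure.pi fun _ : Fin n => ν).real (Set.univ.pi fun i => if i ∈ s then A else Aᶜ) =
          ν.real A ^ j * (1 - ν.real A) ^ (n - j) := by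
      intro s hs
      rw [Finset.mem_powersetCard] at hs
      have hprod : ∀ i, (ν (if i ∈ s then A else Aᶜ)).toReal =
          if i ∈ s then ν.real A else 1 - ν.real A := by
        intro i
        split_ifs
        · rfl
        · exact probReal_compl_eq_one_sub hA
      rw [measureReal_def, Measure.pi_pi, ENNReal.toReal_prod, Finset.prod_congr rfl
        fun i _ => hprod i, Finset.prod_ite]
      simp only [Finset.prod_const]
      congr 2
      · simp [hs.2]
      · have : (Finset.univ.filter fun i => i ∉ s) = sᶜ := by ext; simp
        rw [this, Finset.card_compl, hs.2, Fintype.card_fin]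
    rw [Finset.sum_congr rfl hs]
    simp [mul_assoc]
  · intro s _ t _ hst
    refine Set.disjoint_left.2 fun x hx hx' => hst ?_
    ext i
    have h1 := hx i trivial
    have h2 := hx' i trivial
    by_cases hs : i ∈ s <;> by_cases ht : i ∈ t <;> simp_all
  · intro s _
    refine MeasurableSet.univ_pi fun i => ?_
    split_ifs
    exacts [hA, hA.compl]

theorem measurable_card_filter_univ {X ι : Type*} [MeasurableSpace X] [Fintype ι]
    {s : ι → Set X} [∀ x, DecidablePred fun i => x ∈ s i] (hs : ∀ i, MeasurableSet (s i)) :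
    Measurable fun x => (Finset.univ.filter fun i => x ∈ s i).card := by
  simp_rw [Finset.card_filter]
  refine Finset.measurable_fun_sum _ fun i _ => ?_
  exact Measurable.ite (hs i) measurable_const measurable_const

/-- The number of coordinates of an i.i.d. sample in a fixed set is binomial. -/
theorem map_pi_card_filter_mem {E : Type*} [MeasurableSpace E] (ν : Measure E)
    [IsProbabilityMeasure ν] {A : Set E} [DecidablePred (· ∈ A)] (hA : MeasurableSet A)
    (n : ℕ) (q : unitInterval) (hq : ν.real A = q) :
    (Measure.pi fun _ : Fin n => ν).map (fun x => (Finset.univ.filter fun i => x i ∈ A).card) =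
      binomial n q := by
  have hmeas : Measurable fun x : Fin n → E => (Finset.univ.filter fun i => x i ∈ A).card :=
    measurable_card_filter_univ (s := fun i => {x : Fin n → E | x i ∈ A})
      fun i => measurable_pi_apply i hA
  have := Measure.isProbabilityMeasure_map
    (μ := Measure.pi fun _ : Fin n => ν) hmeas.aemeasurable
  refine Measure.ext_of_measureReal_singleton fun j => ?_
  rw [map_measureReal_apply hmeas (measurableSet_singleton j), binomial_real_singleton, ← hq]
  exact measureReal_pi_card_filter_mem_eq ν hA n j

/-! ### Gaussian contrasts and equicorrelated vectors -/

/-- Orthonormal contrasts of an i.i.d. Gaussian sample, scaled by its standard deviation, are i.i.d.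
standard normal. -/
theorem hasLaw_pi_gaussian_of_orthonormal_contrasts {Ω : Type*} [MeasurableSpace Ω]
    {P : Measure Ω} [IsProbabilityMeasure P] {N m : ℕ} {μ σ : ℝ} (hσ : 0 < σ)
    {Y : Fin N → Ω → ℝ}
    (hlaw : ∀ i, HasLaw (Y i) (gaussianReal μ (Real.toNNReal (σ ^ 2))) P)
    (hindep : iIndepFun Y P) {a : Fin m → Fin N → ℝ} (hsum : ∀ k, ∑ i, a k i = 0)
    (hnorm : ∀ k, ∑ i, a k i * a k i = 1)
    (horth : ∀ k l, k ≠ l → ∑ i, a k i * a l i = 0) :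
    HasLaw (fun ω l => ∑ i, a l i / σ * Y i ω)
      (Measure.pi fun _ : Fin m => gaussianReal 0 1) P := by
  have hG : ∀ i, HasGaussianLaw (Y i) P := fun i => (hlaw i).hasGaussianLaw
  have hL2 : ∀ i, MemLp (Y i) 2 P := fun i => (hG i).memLp_two
  have hmean : ∀ i, ∫ ω, Y i ω ∂P = μ := fun i => by
    rw [(hlaw i).integral_eq, integral_id_gaussianReal]
  have hcovY : ∀ i j, cov[Y i, Y j; P] = if i = j then σ ^ 2 else 0 := by
    intro i j
    split_ifs with h
    · subst h
      rw [covariance_self (hlaw i).aemeasurable, (hlaw i).variance_eq, variance_id_gaussianReal,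
        Real.coe_toNNReal _ (sq_nonneg σ)]
    · exact (hindep.indepFun h).covariance_eq_zero (hL2 i) (hL2 j)
  have hcov : ∀ k l, cov[fun ω => ∑ i, a k i / σ * Y i ω, fun ω => ∑ i, a l i / σ * Y i ω; P] =
      ∑ i, a k i * a l i := by
    intro k l
    rw [covariance_fun_sum_fun_sum (fun i => (hL2 i).const_mul _) (fun i => (hL2 i).const_mul _)]
    simp_rw [covariance_const_mul_left, covariance_const_mul_right, hcovY]
    refine Finset.sum_congr rfl fun i _ => ?_
    simp only [mul_ite, mul_zero, Finset.sum_ite_eq, Finset.mem_univ, if_true]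
    field_simp
  have hjoint : HasGaussianLaw (fun ω l => ∑ i, a l i / σ * Y i ω) P := by
    let L : (Fin N → ℝ) →L[ℝ] (Fin m → ℝ) :=
      ContinuousLinearMap.pi fun l => ∑ i, (a l i / σ) • ContinuousLinearMap.proj i
    have h := (hindep.hasGaussianLaw hG).map L
    refine h.congr (Filter.EventuallyEq.of_eq ?_)
    ext ω l
    simp [L]
  have hmarg : ∀ l, HasLaw (fun ω => ∑ i, a l i / σ * Y i ω) (gaussianReal 0 1) P := by
    intro l
    have hl : HasGaussianLaw (fun ω => ∑ i, a l i / σ * Y i ω) P := hjoint.eval l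
    refine ⟨hl.aemeasurable, ?_⟩
    rw [hl.map_eq_gaussianReal, ← covariance_self hl.aemeasurable, hcov, hnorm,
      integral_finsetSum _ fun i _ => ((hL2 i).integrable one_le_two).const_mul _]
    simp_rw [integral_const_mul, hmean]
    rw [← Finset.sum_mul, ← Finset.sum_div, hsum]
    simp
  -- Jointly Gaussian and uncorrelated implies independent.
  exact (hjoint.iIndepFun_of_covariance_eq_zero fun k l hkl => by
    rw [hcov, horth k l hkl]).hasLaw_pi hmarg

/-- An equicorrelated family of vectors is, up to a common shift, an orthogonal family. -/
theorem exists_orthonormal_shift_of_equicorrelated {N m : ℕ} (hm : 0 < m) {b : Fin m → Fin N → ℝ}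
    {A B : ℝ} (hB : 0 ≤ B) (hAB : B < A) (hdiag : ∀ k, ∑ i, b k i * b k i = A)
    (hoff : ∀ k l, k ≠ l → ∑ i, b k i * b l i = B) (hsum : ∀ k, ∑ i, b k i = 0) :
    ∃ a : Fin m → Fin N → ℝ, ∃ e : Fin N → ℝ,
      (∀ k, ∑ i, a k i = 0) ∧ (∀ k, ∑ i, a k i * a k i = 1) ∧
      (∀ k l, k ≠ l → ∑ i, a k i * a l i = 0) ∧
      ∀ k i, b k i = e i - √(A - B) * a k i := by
  have hm' : (0 : ℝ) < m := Nat.cast_pos.2 hm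
  have hd : 0 < A - B := sub_pos.2 hAB
  set M : ℝ := B + (A - B) / m with hM
  have hMpos : 0 < M := by positivity
  -- With `g` the mean of the `b k`, `M` is both `g · g` and every `b k · g`. The deviations `g - b
  -- k` are orthogonal to `g` and have inner products `(A - B)(δ - 1/m)`; adding `-c g` with `c² M =
  -- (A - B)/m` cancels the `1/m`. The result stays in the span of the `b k`, so its entries still
  -- sum to zero.
  set c : ℝ := √((M - B) / M) with hc
  have hcM : c ^ 2 * M = M - B := by
    rw [hc, Real.sq_sqrt (div_nonneg (by rw [hM, add_sub_cancel_left]; positivity) hMpos.le)]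
    field_simp
  set s : ℝ := √(A - B) with hs
  have hspos : 0 < s := Real.sqrt_pos.2 hd
  have hs2 : s ^ 2 = A - B := Real.sq_sqrt hd.le
  set g : Fin N → ℝ := fun i => (∑ k, b k i) / m with hg
  have hbb : ∀ k l, ∑ i, b k i * b l i = B + if k = l then A - B else 0 := by
    intro k l
    split_ifs with h
    · subst h; rw [hdiag]; ring
    · rw [hoff k l h, add_zero]
  have hbg : ∀ k, ∑ i, b k i * g i = M := by
    intro k
    simp_rw [hg, mul_div_assoc', Finset.mul_sum]
    rw [← Finset.sum_div, Finset.sum_comm]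
    simp_rw [hbb, Finset.sum_add_distrib]
    simp
    rw [hM]
    field_simp
  have hgg : ∑ i, g i * g i = M := by
    have : ∀ i, g i * g i = (∑ k, b k i * g i) / m := fun i => by
      rw [← Finset.sum_mul]; simp only [hg]; ring
    simp_rw [this]
    rw [← Finset.sum_div, Finset.sum_comm]
    simp_rw [hbg]
    simp
    field_simp
  have hgsum : ∑ i, g i = 0 := by
    simp_rw [hg]
    rw [← Finset.sum_div, Finset.sum_comm]
    simp [hsum]
  have haa : ∀ k l, ∑ i, ((1 - c) * g i - b k i) / s * (((1 - c) * g i - b l i) / s) =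
      if k = l then 1 else 0 := by
    intro k l
    have : ∀ i, ((1 - c) * g i - b k i) / s * (((1 - c) * g i - b l i) / s) =
        ((1 - c) ^ 2 * (g i * g i) - (1 - c) * (b k i * g i) - (1 - c) * (b l i * g i)
          + b k i * b l i) / s ^ 2 := fun i => by field_simp; ring
    simp_rw [this]
    rw [← Finset.sum_div, Finset.sum_add_distrib, Finset.sum_sub_distrib, Finset.sum_sub_distrib,
      ← Finset.mul_sum, ← Finset.mul_sum, ← Finset.mul_sum, hgg, hbg, hbg, hbb, hs2,
      div_eq_iff hd.ne']
    split_ifs <;> linear_combination hcM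
  refine ⟨fun k i => ((1 - c) * g i - b k i) / s, fun i => (1 - c) * g i, fun k => ?_,
    fun k => ?_, fun k l hkl => ?_, fun k i => ?_⟩
  · rw [← Finset.sum_div, Finset.sum_sub_distrib, ← Finset.mul_sum, hgsum, hsum]
    simp
  · rw [haa, if_pos rfl]
  · rw [haa, if_neg hkl]
  · field_simp
    ring

/-! ### Quantiles as counts; algebra of the difference in means -/

namespace RandTest

/-- After sorting, the values below `t` form an initial segment, even with ties. The bounds on `j`
exclude the default value 0. -/
theorem orderStat_lt_iff {m : ℕ} (x : Fin m → ℝ) {j : ℕ} (hj : 1 ≤ j) (hjm : j ≤ m) (t : ℝ) :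
    orderStat x j < t ↔ j ≤ (Finset.univ.filter fun l => x l < t).card := by
  have hlt : j - 1 < m := by omega
  rw [orderStat, dif_pos hlt]
  have h := Tuple.lt_card_lt_iff_apply_lt_of_monotone (j := ⟨j - 1, hlt⟩) (a := t)
    (Tuple.monotone_sort x)
  have hcard : (Finset.univ.filter fun l => (x ∘ Tuple.sort x) l < t).card =
      (Finset.univ.filter fun l => x l < t).card :=
    Finset.card_equiv (Tuple.sort x) (by simp)
  rw [hcard] at h
  exact h.symm.trans (by simp only; omega)

/-- With `m = n + 1`, the quantile has rank `m - ⌊mα⌋`, so at least that many of the `n` other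
values must lie strictly below `x k`, leaving at most `⌊mα⌋ - 1` that do not. Ties count against
rejection. The bound is an integer because it equals `-1` when `mα < 1`. -/
theorem lowerQuantile_one_sub_lt_iff {n : ℕ} {α : ℝ} (hα₀ : 0 < α) (hα₁ : α < 1)
    (x : Fin (n + 1) → ℝ) (k : Fin (n + 1)) :
    lowerQuantile (1 - α) x < x k ↔
      (((Finset.univ.filter fun i => x k ≤ x (k.succAbove i)).card : ℕ) : ℤ) ≤
        ⌊((n + 1 : ℕ) : ℝ) * α⌋ - 1 := by
  have hn : (0 : ℝ) < ((n + 1 : ℕ) : ℝ) := by positivity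
  have hceil : ((⌈((n + 1 : ℕ) : ℝ) * (1 - α)⌉₊ : ℕ) : ℤ) =
      (n + 1 : ℕ) - ⌊((n + 1 : ℕ) : ℝ) * α⌋ := by
    rw [Int.natCast_ceil_eq_ceil (mul_nonneg hn.le (by linarith)), mul_sub, mul_one, sub_eq_add_neg,
      Int.ceil_natCast_add, Int.ceil_neg]
    ring
  have hcard : (Finset.univ.filter fun l => x l < x k).card =
      (Finset.univ.filter fun i => x (k.succAbove i) < x k).card := by
    rw [Finset.card_filter, Finset.card_filter, Fin.sum_univ_succAbove _ k]
    simp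
  have hcompl : (Finset.univ.filter fun i => x (k.succAbove i) < x k).card +
      (Finset.univ.filter fun i => x k ≤ x (k.succAbove i)).card = n := by
    have := Finset.card_filter_add_card_filter_not (s := (Finset.univ : Finset (Fin n)))
      (fun i => x (k.succAbove i) < x k)
    simpa using this
  rw [lowerQuantile, orderStat_lt_iff, hcard]
  · omega
  · exact Nat.ceil_pos.2 (mul_pos hn (by linarith))
  · exact Nat.ceil_le.2 (by nlinarith)

variable {N : ℕ}

theorem diffInMeans_eq_sum (z : Assignment N) (y : Fin N → ℝ) :
    diffInMeans z y = ∑ i, transformed z i * y i := by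
  have hne : ∀ i, ¬ z i = 1 ↔ z i = -1 := fun i => by
    rcases Int.units_eq_one_or (z i) with h | h <;> simp [h]
  have hfil : (Finset.univ.filter fun i => ¬ z i = 1) = Finset.univ.filter fun i => z i = -1 := by
    simp_rw [hne]
  simp_rw [diffInMeans, groupMean, transformed, ite_mul]
  rw [Finset.sum_ite, hfil, ← Finset.mul_sum, ← Finset.mul_sum]
  ring

theorem groupSize_add (z : Assignment N) : groupSize z 1 + groupSize z (-1) = N := by
  have hne : ∀ i, ¬ z i = 1 ↔ z i = -1 := fun i => by
    rcases Int.units_eq_one_or (z i) with h | h <;> simp [h]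
  have := Finset.card_filter_add_card_filter_not (s := (Finset.univ : Finset (Fin N)))
      (fun i => z i = 1)
  simpa [groupSize, hne] using this

/-- A common treated proportion makes the transformed vector one fixed affine function of `z`. Since
transformed vectors sum to zero, their mutual inner products are then proportional to the mixed ones
in the hypothesis on `ρ`. -/
theorem transformed_eq {z : Assignment N} {p : ℝ} (hp₀ : 0 < p) (hp₁ : p < 1)
    (hN : (0 : ℝ) < N) (hp : (groupSize z 1 : ℝ) / N = p) (i : Fin N) :
    transformed z i = (((z i : ℤ) : ℝ) + 1 - 2 * p) / (2 * (N * (p * (1 - p)))) := by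
  have h1 : (groupSize z 1 : ℝ) = N * p := by rw [← hp]; field_simp
  have h2 : (groupSize z (-1) : ℝ) = N * (1 - p) := by
    have : (groupSize z 1 : ℝ) + groupSize z (-1) = N := by exact_mod_cast groupSize_add z
    linarith
  have hq : 1 - p ≠ 0 := by linarith
  rw [transformed, h1, h2]
  rcases Int.units_eq_one_or (z i) with h | h
  · simp only [h, if_true, Units.val_one, Int.cast_one]
    field_simp
    ring
  · have : (-1 : ℤˣ) ≠ 1 := by decide
    simp only [h, this, if_false, Units.val_neg, Units.val_one, Int.cast_neg, Int.cast_one]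
    field_simp
    ring

theorem sum_transformed {z : Assignment N} (h1 : groupSize z 1 ≠ 0) (h2 : groupSize z (-1) ≠ 0) :
    ∑ i, transformed z i = 0 := by
  have h := diffInMeans_eq_sum z fun _ => 1
  simp only [mul_one] at h
  rw [← h, diffInMeans, groupMean, groupMean]
  have h1' : (groupSize z 1 : ℝ) ≠ 0 := by exact_mod_cast h1
  have h2' : (groupSize z (-1) : ℝ) ≠ 0 := by exact_mod_cast h2
  simp only [Finset.sum_const, nsmul_eq_mul, mul_one]
  change (groupSize z 1 : ℝ) / _ - (groupSize z (-1) : ℝ) / _ = 0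
  rw [div_self h1', div_self h2', sub_self]

theorem sum_transformed_mul_self {z : Assignment N} (h1 : groupSize z 1 ≠ 0)
    (h2 : groupSize z (-1) ≠ 0) : ∑ i, transformed z i * ((z i : ℤ) : ℝ) = 2 := by
  have h1' : (groupSize z 1 : ℝ) ≠ 0 := by exact_mod_cast h1
  have h2' : (groupSize z (-1) : ℝ) ≠ 0 := by exact_mod_cast h2
  rw [← diffInMeans_eq_sum z fun i => ((z i : ℤ) : ℝ), diffInMeans, groupMean, groupMean]
  have e : ∀ a : ℤˣ, ∑ i ∈ Finset.univ.filter (fun i => z i = a), ((z i : ℤ) : ℝ) =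
      groupSize z a * ((a : ℤ) : ℝ) := by
    intro a
    rw [Finset.sum_congr rfl (g := fun _ => ((a : ℤ) : ℝ))
      fun i hi => by rw [(Finset.mem_filter.1 hi).2]]
    simp [groupSize]
  rw [e, e, mul_div_assoc, mul_div_assoc]
  field_simp
  norm_num

end RandTest

/-! ### Conditioning on one normal coordinate -/

namespace RandTest

theorem measurableSet_card_le {n : ℕ} (k : Fin (n + 1)) (K : ℤ) (θ : ℝ) :
    MeasurableSet {v : Fin (n + 1) → ℝ |
      (((Finset.univ.filter fun i => v (k.succAbove i) ≤ v k - θ).card : ℕ) : ℤ) ≤ K} :=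
  measurable_card_filter_univ
    (s := fun i : Fin n => {v : Fin (n + 1) → ℝ | v (k.succAbove i) ≤ v k - θ})
    (fun i => measurableSet_le (by fun_prop) (by fun_prop)) (MeasurableSet.of_discrete
      (s := {j : ℕ | (j : ℤ) ≤ K}))

/-- For i.i.d. standard normals, the law of the number of the other coordinates that are at most
the `k`-th one minus `θ`, found by conditioning on the `k`-th coordinate. -/
theorem measureReal_pi_gaussian_card_le {n : ℕ} (k : Fin (n + 1)) (K : ℤ) (θ : ℝ) :
    (Measure.pi fun _ : Fin (n + 1) => gaussianReal 0 1).real {v |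
      (((Finset.univ.filter fun i => v (k.succAbove i) ≤ v k - θ).card : ℕ) : ℤ) ≤ K} =
    ∫ x : ℝ, binomialCDF K n (stdNormalCDF (x - θ)) * stdNormalPDF x := by
  set S : Set (ℝ × (Fin n → ℝ)) :=
    {q | (((Finset.univ.filter fun i => q.2 i ≤ q.1 - θ).card : ℕ) : ℤ) ≤ K} with hS
  have hSm : MeasurableSet S := measurable_card_filter_univ
    (s := fun i : Fin n => {q : ℝ × (Fin n → ℝ) | q.2 i ≤ q.1 - θ})
    (fun i => measurableSet_le (by fun_prop) (by fun_prop)) (MeasurableSet.of_discrete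
      (s := {j : ℕ | (j : ℤ) ≤ K}))
  have hmp := measurePreserving_piFinSuccAbove (fun _ : Fin (n + 1) => gaussianReal 0 1) k
  have hpre : {v : Fin (n + 1) → ℝ |
      (((Finset.univ.filter fun i => v (k.succAbove i) ≤ v k - θ).card : ℕ) : ℤ) ≤ K} =
      MeasurableEquiv.piFinSuccAbove (fun _ : Fin (n + 1) => ℝ) k ⁻¹' S := rfl
  rw [hpre, hmp.measureReal_preimage hSm.nullMeasurableSet, ← integral_indicator_one hSm,
    integral_prod (S.indicator (1 : ℝ × (Fin n → ℝ) → ℝ))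
      ((integrable_const (1 : ℝ)).indicator hSm),
    integral_gaussianReal_eq_integral_smul one_ne_zero]
  refine integral_congr_ae (Filter.Eventually.of_forall fun x => ?_)
  have hsec : ∀ w, S.indicator (1 : ℝ × (Fin n → ℝ) → ℝ) (x, w) =
      (Prod.mk x ⁻¹' S).indicator 1 w := fun w => rfl
  have hcount : Measurable fun w : Fin n → ℝ =>
      (Finset.univ.filter fun i => w i ∈ Set.Iic (x - θ)).card :=
    measurable_card_filter_univ (s := fun i => {w : Fin n → ℝ | w i ∈ Set.Iic (x - θ)})
      fun i => measurable_pi_apply i measurableSet_Iic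
  simp only [hsec, smul_eq_mul]
  rw [integral_indicator_one (measurable_prodMk_left hSm), mul_comm, stdNormalPDF, binomialCDF,
    ← map_pi_card_filter_mem (gaussianReal 0 1) (A := Set.Iic (x - θ)) measurableSet_Iic n
      (stdNormalCDF (x - θ)) (cdf_eq_real _ _).symm,
    map_measureReal_apply hcount MeasurableSet.of_discrete]
  rfl

end RandTest

/-! ### The average power -/

theorem theorem4 {Ω : Type*} [MeasurableSpace Ω] (P : Measure Ω) [IsProbabilityMeasure P]
    {N m : ℕ} (hm : 0 < m)
    (α : ℝ) (hα₀ : 0 < α) (hα₁ : α < 1)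
    (τ μ σ : ℝ) (hσ : 0 < σ)
    -- the base outcomes are i.i.d. with law `N(μ, σ²)`
    (Y₀ : Fin N → Ω → ℝ)
    (hlaw : ∀ i, HasLaw (Y₀ i) (gaussianReal μ (Real.toNNReal (σ ^ 2))) P)
    (hindep : iIndepFun Y₀ P)
    -- the `m` assignments
    (z : Fin m → RandTest.Assignment N)
    -- common proportion of treated units
    (p : ℝ) (hp₀ : 0 < p) (hp₁ : p < 1)
    (hp : ∀ k, (RandTest.groupSize (z k) 1 : ℝ) / (N : ℝ) = p)
    -- common normalized inner product of different assignments
    (ρ : ℝ) (hρ₀ : 0 ≤ ρ) (hρ₁ : ρ < 1)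
    (hρ : ∀ k l, k ≠ l →
      (∑ i, RandTest.transformed (z k) i * (((z l i : ℤˣ) : ℤ) : ℝ)) / 2 = ρ) :
    RandTest.averagePower P Y₀ α τ z =
      ∫ x : ℝ, RandTest.binomialCDF (⌊(m : ℝ) * α⌋ - 1) (m - 1)
          (RandTest.stdNormalCDF (x - τ / σ * √((N : ℝ) * (p * (1 - p)) * (1 - ρ)))) *
        RandTest.stdNormalPDF x := by
  obtain ⟨n, rfl⟩ : ∃ n, m = n + 1 := ⟨m - 1, by omega⟩
  -- For `N = 0` the ratio in `hp` is 0 by convention, contradicting `0 < p`.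
  have hN : (0 : ℝ) < N := by
    rcases Nat.eq_zero_or_pos N with h | h
    · have := hp 0
      simp only [h, Nat.cast_zero, div_zero] at this
      exact absurd this hp₀.ne
    · exact_mod_cast h
  have hq : 0 < 1 - p := by linarith
  have hr : 0 < 1 - ρ := by linarith
  set C : ℝ := N * (p * (1 - p)) with hC
  have hCpos : 0 < C := by positivity
  have h1 : ∀ k, RandTest.groupSize (z k) 1 ≠ 0 := fun k h => by
    have := hp k
    simp only [h, Nat.cast_zero, zero_div] at this
    exact hp₀.ne this
  have h2 : ∀ k, RandTest.groupSize (z k) (-1) ≠ 0 := fun k h => by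
    have hk := RandTest.groupSize_add (z k)
    rw [h, add_zero] at hk
    have := hp k
    rw [hk, div_self hN.ne'] at this
    exact hp₁.ne this.symm
  have hsum : ∀ k, ∑ i, RandTest.transformed (z k) i = 0 := fun k =>
    RandTest.sum_transformed (h1 k) (h2 k)
  have hdot : ∀ k l, ∑ i, RandTest.transformed (z k) i * RandTest.transformed (z l) i =
      (∑ i, RandTest.transformed (z k) i * ((z l i : ℤ) : ℝ)) / (2 * C) := by
    intro k l
    have : ∀ i, RandTest.transformed (z k) i * RandTest.transformed (z l) i =
        (RandTest.transformed (z k) i * ((z l i : ℤ) : ℝ) +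
          (1 - 2 * p) * RandTest.transformed (z k) i) / (2 * C) :=
      fun i => by rw [RandTest.transformed_eq hp₀ hp₁ hN (hp l) i]; ring
    simp_rw [this]
    rw [← Finset.sum_div, Finset.sum_add_distrib, ← Finset.mul_sum, hsum, mul_zero, add_zero]
  -- The mixed products are `2` on the diagonal and `2ρ` off it; `hdot` divides them by `2C`.
  obtain ⟨a, e, ha0, ha1, haorth, hb⟩ := exists_orthonormal_shift_of_equicorrelated hm
    (b := fun k => RandTest.transformed (z k)) (A := 1 / C) (B := ρ / C) (by positivity)
    (by gcongr) (fun k => by rw [hdot, RandTest.sum_transformed_mul_self (h1 k) (h2 k)]; field_simp)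
    (fun k l hkl => by rw [hdot, ← hρ k l hkl]; field_simp) hsum
  set θ : ℝ := τ / σ * √(C * (1 - ρ)) with hθ
  set s : ℝ := √(1 / C - ρ / C) with hs
  have hspos : 0 < s := Real.sqrt_pos.2 (by rw [← sub_div]; positivity)
  -- The treatment gap `τ - τρ`, in units of the noise scale `sσ`, is `θ`.
  have hsθ : s * σ * θ = τ * (1 - ρ) := by
    have : s * √(C * (1 - ρ)) = 1 - ρ := by
      rw [hs, ← Real.sqrt_mul (by rw [← sub_div]; positivity), ← sub_div,
        show (1 - ρ) / C * (C * (1 - ρ)) = (1 - ρ) ^ 2 by field_simp, Real.sqrt_sq hr.le]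
    calc s * σ * θ = τ * (s * √(C * (1 - ρ))) * (σ / σ) := by rw [hθ]; ring
      _ = τ * (1 - ρ) := by rw [this, div_self hσ.ne', mul_one]
  have hV := hasLaw_pi_gaussian_of_orthonormal_contrasts hσ hlaw hindep ha0 ha1 haorth
  set V : Ω → Fin (n + 1) → ℝ := fun ω l => ∑ i, a l i / σ * Y₀ i ω with hVdef
  set K : ℤ := ⌊((n + 1 : ℕ) : ℝ) * α⌋ - 1 with hK
  let S : Fin (n + 1) → Set (Fin (n + 1) → ℝ) := fun k => {v |
    (((Finset.univ.filter fun i => v (k.succAbove i) ≤ v k - θ).card : ℕ) : ℤ) ≤ K}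
  have hSm : ∀ k, MeasurableSet (S k) := fun k => RandTest.measurableSet_card_le k K θ
  have hrej : ∀ ω k,
      RandTest.Rejects α z k (RandTest.potentialOutcome τ (fun i => Y₀ i ω) (z k)) ↔ V ω ∈ S k := by
    intro ω k
    have hT : ∀ l,
        RandTest.diffInMeans (z l) (RandTest.potentialOutcome τ (fun i => Y₀ i ω) (z k)) =
        τ / 2 * (∑ i, RandTest.transformed (z l) i * ((z k i : ℤ) : ℝ)) + ∑ i, e i * Y₀ i ω
          - s * σ * V ω l := by
      intro l
      rw [RandTest.diffInMeans_eq_sum, hVdef, Finset.mul_sum, Finset.mul_sum, ← Finset.sum_add_distrib,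
        ← Finset.sum_sub_distrib]
      refine Finset.sum_congr rfl fun i _ => ?_
      have := hb l i
      rw [RandTest.potentialOutcome, mul_add]
      -- Only the factor of `Y₀` is decomposed; the one paired with `z k` is kept for `hρ`.
      nth_rewrite 2 [this]
      field_simp
      ring
    have hiff : ∀ i,
        RandTest.diffInMeans (z k) (RandTest.potentialOutcome τ (fun i => Y₀ i ω) (z k)) ≤
        RandTest.diffInMeans (z (k.succAbove i)) (RandTest.potentialOutcome τ (fun i => Y₀ i ω) (z k)) ↔
        V ω (k.succAbove i) ≤ V ω k - θ := by
      intro i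
      have h := hρ (k.succAbove i) k (Fin.succAbove_ne k i)
      rw [hT, hT, RandTest.sum_transformed_mul_self (h1 k) (h2 k),
        show (∑ j, RandTest.transformed (z (k.succAbove i)) j * ((z k j : ℤ) : ℝ)) = 2 * ρ by linarith,
        ← mul_le_mul_iff_right₀ (mul_pos hspos hσ) (b := V ω (k.succAbove i)), mul_sub, hsθ]
      constructor <;> intro h <;> linarith
    rw [RandTest.Rejects, RandTest.lowerQuantile_one_sub_lt_iff hα₀ hα₁
      (fun l => RandTest.diffInMeans (z l) (RandTest.potentialOutcome τ (fun i => Y₀ i ω) (z k)))]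
    simp only [hiff]
    rfl
  have hpower : ∀ ω, RandTest.power α τ z (fun i => Y₀ i ω) =
      (1 / ((n + 1 : ℕ) : ℝ)) * ∑ k, (S k).indicator (1 : (Fin (n + 1) → ℝ) → ℝ) (V ω) := by
    intro ω
    rw [RandTest.power]
    congr 1
    refine Finset.sum_congr rfl fun k _ => ?_
    simp [Set.indicator_apply, hrej]
  have hint : ∀ k, Integrable ((S k).indicator (1 : (Fin (n + 1) → ℝ) → ℝ))
      (Measure.pi fun _ : Fin (n + 1) => gaussianReal 0 1) :=
    fun k => (integrable_const (1 : ℝ)).indicator (hSm k)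
  have hcomp := hV.integral_comp (f := fun v => (1 / ((n + 1 : ℕ) : ℝ)) *
    ∑ k, (S k).indicator (1 : (Fin (n + 1) → ℝ) → ℝ) v)
    ((integrable_finsetSum _ fun k _ => hint k).const_mul _).aestronglyMeasurable
  rw [RandTest.averagePower, integral_congr_ae (Filter.Eventually.of_forall hpower)]
  refine hcomp.trans ?_
  rw [integral_const_mul, integral_finsetSum _ fun k _ => hint k]
  simp_rw [integral_indicator_one (hSm _)]
  -- The value does not depend on `k`, so the average over realized assignments is trivial.
  have hk : ∀ k, (Measure.pi fun _ : Fin (n + 1) => gaussianReal 0 1).real (S k) = _ :=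
    fun k => RandTest.measureReal_pi_gaussian_card_le k K θ
  simp_rw [hk, Finset.sum_const, Finset.card_univ, Fintype.card_fin, nsmul_eq_mul]
  rw [← mul_assoc, one_div_mul_cancel (by positivity), one_mul, Nat.add_sub_cancel]
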